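/- Let $\alpha\in(0,1)$ and let $\lambda:[0,\infty)\to(0,\infty)$ be locally integrable with $\Lambda(t):=\int_0^t\lambda(\tau)\,d\tau\to\infty$ as $t\to\infty$. On a probability space $(\Omega,\mathcal E,\mathbb P)$ let $N_1$ be a standard Poisson process of rate $1$, put $N(t):=N_1(\Lambda(t))$, let $L_\alpha$ be an $\alpha$-stable subordinator, i.e. a càdlàg Lévy process with $\mathbb E[e^{-uL_\alpha(t)}]=e^{-tu^\alpha}$ for all $u,t\ge 0$, and let $Y_\alpha(t):=\inf\{u\ge 0: L_\alpha(u)>t\}$ be its inverse. Assume that the process $(Y_\alpha(t))_{t\ge0}$ is independent of $(N(t))_{t\ge 0}$, and let $N_\alpha(t):=N(Y_\alpha(t))$ be the fractional non-homogeneous Poisson process. Let $\mathcal F_0:=\sigma(Y_\alpha(t),\,t\ge 0)$ be the initial history. Then $\mathcal F_t:=\mathcal F_0\vee\sigma(N_\alpha(s),\,s\le t)$, $t\ge 0$, is a filtration to which $N_\alpha$ is adapted, and there is on $\Omega$ a random variable $W\sim N(0,1)$ independent of $\mathcal F_0$ such that $$\frac{N(Y_\alpha(T))-\Lambda(Y_\alpha(T))}{\sqrt{\Lambda(Y_\alpha(T))}}\;\xrightarrow[T\to\infty]{}\;W\qquad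 \mathcal F_0\text{-stably}.$$ Here $X_T\to W$ $\mathcal F_0$-stably means that $\mathbb P(\{X_T\in A\}\cap B)\to\mathbb P(\{W\in A\}\cap B)$ as $T\to\infty$ for all $B\in\mathcal F_0$ and all Borel sets $A\subseteq\mathbb R$ with $\mathbb P(W\in\partial A)=0$. -/

import Mathlib

open MeasureTheory ProbabilityTheory Filter Topology
open scoped NNReal ENNReal

namespace FractionalPoisson

/-- `N` is a standard (homogeneous, rate one) Poisson process on `[0, ∞)`. Its paths are counting
functions: nondecreasing, right-continuous and integer valued, so the subtraction of natural numbers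
below is never truncated. -/
structure IsStandardPoisson {Ω : Type*} [MeasurableSpace Ω] (N : ℝ≥0 → Ω → ℕ)
    (P : Measure Ω) : Prop where
  measurable : ∀ t, Measurable (N t)
  mono : ∀ ω, Monotone fun t => N t ω
  rightCont : ∀ ω t, ContinuousWithinAt (fun s => N s ω) (Set.Ici t) t
  zero : ∀ᵐ ω ∂P, N 0 ω = 0
  indep : HasIndepIncrements N P
  law : ∀ s t, s ≤ t → HasLaw (fun ω => N t ω - N s ω) (poissonMeasure (t - s)) P

/-- `L` is a real-valued Lévy process with càdlàg paths. -/
structure IsLevy {Ω : Type*} [MeasurableSpace Ω] (L : ℝ≥0 → Ω → ℝ) (P : Measure Ω) : Prop where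
  measurable : ∀ t, Measurable (L t)
  rightCont : ∀ ω t, ContinuousWithinAt (fun s => L s ω) (Set.Ici t) t
  leftLim : ∀ ω t, ∃ l : ℝ, Tendsto (fun s => L s ω) (𝓝[<] t) (𝓝 l)
  zero : ∀ᵐ ω ∂P, L 0 ω = 0
  indep : HasIndepIncrements L P
  stationary : ∀ s t, IdentDistrib (fun ω => L (s + t) ω - L s ω) (L t) P P

/-- `L` is an `α`-stable subordinator: a Lévy process with `E[exp(-u L(t))] = exp(-t u ^ α)`
for all `u, t ≥ 0`. -/
structure IsStableSubordinator {Ω : Type*} [MeasurableSpace Ω] (α : ℝ) (L : ℝ≥0 → Ω → ℝ)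
    (P : Measure Ω) : Prop extends IsLevy L P where
  laplace : ∀ t u : ℝ≥0,
    Integrable (fun ω => Real.exp (-((u : ℝ) * L t ω))) P ∧
      ∫ ω, Real.exp (-((u : ℝ) * L t ω)) ∂P = Real.exp (-((t : ℝ) * (u : ℝ) ^ α))

/-- The inverse process `Y(t) = inf {u ≥ 0 : L(u) > t}`. -/
noncomputable def inverseSubordinator {Ω : Type*} (L : ℝ≥0 → Ω → ℝ) (t : ℝ≥0) (ω : Ω) : ℝ≥0 :=
  sInf {u : ℝ≥0 | (t : ℝ) < L u ω}

/-- The cumulative rate `Λ(t) = ∫₀ᵗ lam(τ) dτ`. -/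
noncomputable def cumRate (lam : ℝ → ℝ) (t : ℝ≥0) : ℝ :=
  ∫ τ in (0 : ℝ)..(t : ℝ), lam τ

/-- `lam : [0, ∞) → (0, ∞)` is locally integrable and `Λ(t) → ∞`. Only the values of `lam` on
`[0, ∞)` matter. -/
structure IsRate (lam : ℝ → ℝ) : Prop where
  pos : ∀ τ, 0 ≤ τ → 0 < lam τ
  locInt : LocallyIntegrableOn lam (Set.Ici 0)
  tendsto : Tendsto (cumRate lam) atTop atTop

/-- The non-homogeneous Poisson process `N(t) = N₁(Λ(t))`. (`Λ(t) ≥ 0` for every rate function.) -/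
noncomputable def nonhomPoisson {Ω : Type*} (N₁ : ℝ≥0 → Ω → ℕ) (lam : ℝ → ℝ)
    (t : ℝ≥0) (ω : Ω) : ℕ :=
  N₁ (cumRate lam t).toNNReal ω

/-- The fractional non-homogeneous Poisson process `N_α(t) = N(Y_α(t))`. -/
noncomputable def fnpp {Ω : Type*} (N₁ : ℝ≥0 → Ω → ℕ) (lam : ℝ → ℝ)
    (L : ℝ≥0 → Ω → ℝ) (t : ℝ≥0) (ω : Ω) : ℕ :=
  nonhomPoisson N₁ lam (inverseSubordinator L t ω) ω

/-- The initial history `σ(Y(t), t ≥ 0)`. -/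
abbrev initialHistory {Ω : Type*} (Y : ℝ≥0 → Ω → ℝ≥0) : MeasurableSpace Ω :=
  ⨆ t, MeasurableSpace.comap (Y t) inferInstance

/-- The natural history `σ(X(s), s ≤ t)`. -/
abbrev naturalHistory {Ω : Type*} (X : ℝ≥0 → Ω → ℕ) (t : ℝ≥0) : MeasurableSpace Ω :=
  ⨆ s, ⨆ (_ : s ≤ t), MeasurableSpace.comap (X s) inferInstance

/-- `X i → Z` in distribution, `𝓖`-stably, along the filter `l`:
`P({X i ∈ A} ∩ B) → P({Z ∈ A} ∩ B)` for all `B ∈ 𝓖` and all Borel `A` with `P(Z ∈ ∂A) = 0`,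
where `𝓖` is a sub-`σ`-algebra and the `X i` and `Z` are real random variables. -/
structure TendstoStably {ι Ω : Type*} (𝓖 : MeasurableSpace Ω) [mΩ : MeasurableSpace Ω]
    (X : ι → Ω → ℝ) (l : Filter ι) (Z : Ω → ℝ) (P : Measure Ω) : Prop where
  sub : 𝓖 ≤ mΩ
  measurable : ∀ i, Measurable (X i)
  measurable_limit : Measurable Z
  tendsto : ∀ B, MeasurableSet[𝓖] B → ∀ A : Set ℝ, MeasurableSet A → P (Z ⁻¹' frontier A) = 0 →
    Tendsto (fun i => P (X i ⁻¹' A ∩ B)) l (𝓝 (P (Z ⁻¹' A ∩ B)))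

end FractionalPoisson

/-!
The normalised process at time `T` is `(n - m) / √m` with `m = Λ(Y(T))` and `n = N₁(m)`. The rate-one
process `N₁` is independent of `𝓕₀ = σ(Y(t), t ≥ 0)`: the hypothesis concerns `N₁ ∘ Λ`, but `Λ` is
continuous from `0` to `∞`, hence onto (`indep_initialHistory`). For a set `A` and an event `B ∈ 𝓕₀`
one may therefore freeze the random time (`measure_eval_inter_eq_lintegral`):
`P(X_T ∈ A, B) = ∫_B φ(Λ(Y(T))) dP`, where `φ(m)` is the probability that `(n - m) / √m ∈ A` for a
Poisson variable `n` of parameter `m`. Freezing needs `N₁` to be jointly measurable in time and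
chance with respect to its own `σ`-algebra, which follows from right-continuity
(`measurable_uncurry_of_rightCont`).

By the Poisson central limit theorem, read off from characteristic functions, `φ(m)` tends to the
Gaussian mass of `A` as `m → ∞` whenever the boundary of `A` is null
(`tendsto_poissonMeasure_standardize`). The inverse subordinator tends to infinity almost surely
(`tendsto_inverseSubordinator_atTop`), because the Laplace transform of `L(t)` vanishes as `t → ∞`
(`IsStableSubordinator.ae_unbounded`). Dominated convergence then gives the limit `γ(A) P(B)`, where
`γ` is the standard Gaussian law.

The limit variable `W` has to live on the given space. It is taken to be a function of the Poisson
process, which makes it independent of `𝓕₀`: if `T₁` is the first jump time, `exp (-T₁)` is uniform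
on `[0, 1]`, and every law on `ℝ` is an image of the uniform one
(`IsStandardPoisson.exists_gaussian`).
-/

namespace FractionalPoisson

/-! ### Right-continuous processes and passage times -/

/-- The right endpoint `(⌊(n + 1) t⌋ + 1) / (n + 1)` of the cell of the grid `ℕ / (n + 1)` that
contains `t`. -/
noncomputable def gridPoint (n : ℕ) (t : ℝ≥0) : ℝ≥0 :=
  ((⌊((n : ℝ≥0) + 1) * t⌋₊ : ℝ≥0) + 1) / (n + 1)

lemma le_gridPoint (n : ℕ) (t : ℝ≥0) : t ≤ gridPoint n t := by
  rw [gridPoint, le_div_iff₀ (by positivity), mul_comm]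
  exact (Nat.lt_floor_add_one _).le

lemma gridPoint_le (n : ℕ) (t : ℝ≥0) : gridPoint n t ≤ t + 1 / ((n : ℝ≥0) + 1) := by
  rw [gridPoint, div_le_iff₀ (by positivity), add_mul t, div_mul_cancel₀ _ (by positivity),
    mul_comm t]
  gcongr
  exact Nat.floor_le (by positivity)

lemma tendsto_gridPoint (t : ℝ≥0) :
    Tendsto (fun n => gridPoint n t) atTop (𝓝[Set.Ici t] t) := by
  refine tendsto_nhdsWithin_iff.2 ⟨?_, .of_forall fun n => le_gridPoint n t⟩
  refine tendsto_of_tendsto_of_tendsto_of_le_of_le tendsto_const_nhds ?_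
    (fun n => le_gridPoint n t) (fun n => gridPoint_le n t)
  simpa using tendsto_const_nhds.add (tendsto_one_div_add_atTop_nhds_zero_nat (𝕜 := ℝ≥0))

/-- A right-continuous process is the limit of its values at the next grid point, which depend on
time through countably many values only. -/
lemma measurable_uncurry_of_rightCont {Ω β : Type*} [MeasurableSpace Ω] [TopologicalSpace β]
    [TopologicalSpace.PseudoMetrizableSpace β] [MeasurableSpace β] [BorelSpace β]
    {X : ℝ≥0 → Ω → β} (hX : ∀ t, Measurable (X t))
    (hr : ∀ ω t, ContinuousWithinAt (fun s => X s ω) (Set.Ici t) t) :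
    Measurable fun p : ℝ≥0 × Ω => X p.1 p.2 := by
  refine measurable_of_tendsto_metrizable (f := fun n (p : ℝ≥0 × Ω) => X (gridPoint n p.1) p.2)
    (fun n => ?_) (tendsto_pi_nhds.2 fun p => (hr p.2 p.1).tendsto.comp (tendsto_gridPoint p.1))
  have h : Measurable fun q : ℕ × Ω => X (((q.1 : ℝ≥0) + 1) / (n + 1)) q.2 := by
    refine measurable_from_prod_countable_right fun k => ?_
    exact hX (((k : ℝ≥0) + 1) / (n + 1))
  have hfl : Measurable fun p : ℝ≥0 × Ω => (⌊((n : ℝ≥0) + 1) * p.1⌋₊, p.2) :=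
    (Nat.measurable_floor.comp (measurable_fst.const_mul _)).prodMk measurable_snd
  simpa only [gridPoint, Function.comp_def] using h.comp hfl

/-- A right-continuous function that exceeds a level somewhere does so at a point of a fixed
countable dense set, which reduces the passage times to countably many coordinates. -/
lemma exists_denseSeq_of_rightCont {f : ℝ≥0 → ℝ}
    (hr : ∀ t, ContinuousWithinAt f (Set.Ici t) t) {c : ℝ} {u s : ℝ≥0} (hu : c < f u)
    (hus : u < s) : ∃ n, TopologicalSpace.denseSeq ℝ≥0 n < s ∧
      c < f (TopologicalSpace.denseSeq ℝ≥0 n) := by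
  have h : ∀ᶠ v in 𝓝[>] u, c < f v :=
    ((hr u).tendsto.eventually (lt_mem_nhds hu)).filter_mono
      (nhdsWithin_mono _ Set.Ioi_subset_Ici_self)
  obtain ⟨w, hw, hw'⟩ := (mem_nhdsGT_iff_exists_Ioo_subset' hus).1 h
  obtain ⟨n, hn⟩ := (TopologicalSpace.denseRange_denseSeq ℝ≥0).exists_mem_open
    (isOpen_Ioo (a := u) (b := min w s)) (Set.nonempty_Ioo.2 (lt_min hw hus))
  exact ⟨n, hn.2.trans_le (min_le_right _ _), hw' ⟨hn.1, hn.2.trans_le (min_le_left _ _)⟩⟩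

lemma measurable_inverseSubordinator {Ω : Type*} [MeasurableSpace Ω] {L : ℝ≥0 → Ω → ℝ}
    (hL : ∀ t, Measurable (L t))
    (hr : ∀ ω t, ContinuousWithinAt (fun s => L s ω) (Set.Ici t) t) (t : ℝ≥0) :
    Measurable (inverseSubordinator L t) := by
  refine measurable_of_Iio fun s => ?_
  let d := TopologicalSpace.denseSeq ℝ≥0
  -- The second set collects the paths that never exceed `t`, where the infimum of `∅` is `0`.
  have key : inverseSubordinator L t ⁻¹' Set.Iio s =
      (⋃ n, {ω | d n < s ∧ (t : ℝ) < L (d n) ω}) ∪ ({_ω | 0 < s} ∩ ⋂ n, {ω | L (d n) ω ≤ t}) := by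
    ext ω
    simp only [Set.mem_preimage, Set.mem_Iio, Set.mem_union, Set.mem_iUnion, Set.mem_inter_iff,
      Set.mem_iInter, Set.mem_ofPred_eq,
      inverseSubordinator]
    constructor
    · intro h
      rcases Set.eq_empty_or_nonempty {u : ℝ≥0 | (t : ℝ) < L u ω} with he | hne
      · refine .inr ⟨zero_le.trans_lt h, fun n => ?_⟩
        by_contra! hn
        exact (he ▸ (show d n ∈ {u : ℝ≥0 | (t : ℝ) < L u ω} from hn) : d n ∈ (∅ : Set ℝ≥0))
      · obtain ⟨u, hu, hus⟩ := exists_lt_of_csInf_lt hne h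
        exact .inl (exists_denseSeq_of_rightCont (hr ω) hu hus)
    · rintro (⟨n, hn, hn'⟩ | ⟨hs, hn⟩)
      · exact (csInf_le' (show d n ∈ {u : ℝ≥0 | (t : ℝ) < L u ω} from hn')).trans_lt hn
      · have he : {u : ℝ≥0 | (t : ℝ) < L u ω} = ∅ := by
          refine Set.eq_empty_of_forall_notMem fun u hu => ?_
          obtain ⟨n, -, h⟩ := exists_denseSeq_of_rightCont (hr ω) hu (lt_add_one u)
          exact (hn n).not_gt h
        simpa [he] using hs
  rw [key]
  refine .union (.iUnion fun n => ?_) ?_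
  · exact (MeasurableSet.const _).inter (measurableSet_lt measurable_const (hL _))
  · refine (MeasurableSet.const _).inter ?_
    exact .iInter fun n => measurableSet_le (hL _) measurable_const

/-- A function with right and left limits is bounded on compact intervals. -/
lemma bddAbove_image_Icc_of_cadlag {f : ℝ≥0 → ℝ}
    (hr : ∀ t, ContinuousWithinAt f (Set.Ici t) t)
    (hl : ∀ t, ∃ l : ℝ, Tendsto f (𝓝[<] t) (𝓝 l)) (M : ℝ≥0) :
    BddAbove (f '' Set.Icc 0 M) := by
  refine isCompact_Icc.induction_on (p := fun s => BddAbove (f '' s)) (by simp)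
    (fun s t hst ht => ht.mono (Set.image_mono hst))
    (fun s t hs ht => by rw [Set.image_union]; exact hs.union ht) fun t _ => ?_
  obtain ⟨l, hl⟩ := hl t
  have h1 : ∀ᶠ s in 𝓝[<] t, f s ≤ max (l + 1) (f t + 1) :=
    (hl.eventually (gt_mem_nhds (lt_add_one l))).mono fun s hs => hs.le.trans (le_max_left _ _)
  have h2 : ∀ᶠ s in 𝓝[≥] t, f s ≤ max (l + 1) (f t + 1) :=
    ((hr t).tendsto.eventually (gt_mem_nhds (lt_add_one (f t)))).mono
      fun s hs => hs.le.trans (le_max_right _ _)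
  have h3 : ∀ᶠ s in 𝓝 t, f s ≤ max (l + 1) (f t + 1) := by
    rw [← nhdsLT_sup_nhdsGE]; exact eventually_sup.2 ⟨h1, h2⟩
  refine ⟨_, mem_nhdsWithin_of_mem_nhds h3, max (l + 1) (f t + 1), ?_⟩
  rintro _ ⟨s, hs, rfl⟩
  exact hs

/-- Monotonicity of the paths is not needed: a càdlàg path is bounded by some `C` on `[0, M]`, so the
levels above `C` are passed after time `M`. -/
lemma tendsto_inverseSubordinator_atTop {Ω : Type*} {L : ℝ≥0 → Ω → ℝ} {ω : Ω}
    (hr : ∀ t, ContinuousWithinAt (fun s => L s ω) (Set.Ici t) t)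
    (hl : ∀ t, ∃ l : ℝ, Tendsto (fun s => L s ω) (𝓝[<] t) (𝓝 l))
    (hub : ∀ K : ℕ, ∃ u, (K : ℝ) < L u ω) :
    Tendsto (fun t => inverseSubordinator L t ω) atTop atTop := by
  refine tendsto_atTop.2 fun M => ?_
  obtain ⟨C, hC⟩ := bddAbove_image_Icc_of_cadlag hr hl M
  filter_upwards [eventually_ge_atTop C.toNNReal] with t ht
  have hne : {u : ℝ≥0 | (t : ℝ) < L u ω}.Nonempty := by
    obtain ⟨K, hK⟩ := exists_nat_ge (t : ℝ)
    obtain ⟨u, hu⟩ := hub K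
    exact ⟨u, hK.trans_lt hu⟩
  refine le_csInf hne fun u hu => ?_
  by_contra! huM
  have h1 : L u ω ≤ C := hC ⟨u, ⟨zero_le, huM.le⟩, rfl⟩
  have h2 : C ≤ t := (Real.le_coe_toNNReal C).trans (by exact_mod_cast ht)
  exact (h1.trans h2).not_gt hu

/-- By Markov's inequality, `P(L(t) ≤ K) ≤ exp K * E[exp (-L(t))] = exp (K - t) → 0`. -/
lemma IsStableSubordinator.ae_unbounded {Ω : Type*} [MeasurableSpace Ω] {P : Measure Ω}
    [IsProbabilityMeasure P] {α : ℝ} {L : ℝ≥0 → Ω → ℝ} (hL : IsStableSubordinator α L P) :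
    ∀ᵐ ω ∂P, ∀ K : ℕ, ∃ u, (K : ℝ) < L u ω := by
  refine ae_all_iff.2 fun K => ?_
  have hbound : ∀ n : ℕ, P.real {ω | ¬ ∃ u, (K : ℝ) < L u ω} ≤ Real.exp (K - n) := fun n => by
    obtain ⟨hi, he⟩ := hL.laplace n 1
    simp only [NNReal.coe_one, one_mul, Real.one_rpow, mul_one, NNReal.coe_natCast] at hi he
    have hm := mul_meas_ge_le_integral_of_nonneg (μ := P)
      (.of_forall fun ω => (Real.exp_pos _).le) hi (Real.exp (-K))
    rw [he] at hm
    have hle : P.real {ω | ¬ ∃ u, (K : ℝ) < L u ω} ≤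
        P.real {ω | Real.exp (-K) ≤ Real.exp (-L n ω)} := by
      refine measureReal_mono fun ω hω => ?_
      simp only [not_exists, not_lt, Set.mem_ofPred_eq] at hω
      simpa using hω n
    rw [sub_eq_add_neg, Real.exp_add, ← div_le_iff₀' (Real.exp_pos _), div_eq_mul_inv,
      ← Real.exp_neg, mul_comm]
    exact (mul_le_mul_of_nonneg_left hle (Real.exp_pos _).le).trans hm
  have h0 : Tendsto (fun n : ℕ => Real.exp ((K : ℝ) - n)) atTop (𝓝 0) :=
    Real.tendsto_exp_atBot.comp
      (tendsto_atBot_add_const_left _ _ (tendsto_neg_atTop_atBot.comp tendsto_natCast_atTop_atTop))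
  have := le_antisymm (ge_of_tendsto' h0 hbound) measureReal_nonneg
  exact (measureReal_eq_zero_iff).1 this

/-! ### The cumulative rate and independence -/

lemma IsRate.integrableOn {lam : ℝ → ℝ} (h : IsRate lam) (t : ℝ≥0) :
    IntegrableOn lam (Set.uIcc 0 (t : ℝ)) := by
  refine h.locInt.integrableOn_compact_subset ?_ isCompact_uIcc
  rw [Set.uIcc_of_le t.coe_nonneg]
  exact Set.Icc_subset_Ici_self

lemma IsRate.cumRate_nonneg {lam : ℝ → ℝ} (h : IsRate lam) (t : ℝ≥0) : 0 ≤ cumRate lam t :=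
  intervalIntegral.integral_nonneg t.coe_nonneg fun τ hτ => (h.pos τ hτ.1).le

lemma IsRate.continuous_cumRate {lam : ℝ → ℝ} (h : IsRate lam) : Continuous (cumRate lam) := by
  refine continuous_iff_continuousAt.2 fun t => ?_
  have h1 := intervalIntegral.continuousOn_primitive_interval (h.integrableOn (t + 1))
  rw [Set.uIcc_of_le (t + 1).coe_nonneg] at h1
  have h2 : ContinuousOn (cumRate lam) (Set.Icc 0 (t + 1)) :=
    h1.comp NNReal.continuous_coe.continuousOn fun s hs => ⟨s.coe_nonneg, NNReal.coe_le_coe.2 hs.2⟩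
  exact h2.continuousAt (mem_of_superset (Iio_mem_nhds (lt_add_one t))
    fun s hs => ⟨zero_le, (Set.mem_Iio.1 hs).le⟩)

lemma IsRate.exists_cumRate_eq {lam : ℝ → ℝ} (h : IsRate lam) (s : ℝ≥0) :
    ∃ t, (cumRate lam t).toNNReal = s := by
  obtain ⟨T, hT⟩ := (h.tendsto.eventually_ge_atTop (s : ℝ)).exists
  have h0 : cumRate lam 0 = 0 := by simp [cumRate]
  obtain ⟨t, -, ht⟩ := intermediate_value_Icc (zero_le (a := T)) h.continuous_cumRate.continuousOn
    (show (s : ℝ) ∈ Set.Icc (cumRate lam 0) (cumRate lam T) from ⟨h0.trans_le s.coe_nonneg, hT⟩)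
  exact ⟨t, by rw [ht, Real.toNNReal_coe]⟩

/-- The `σ`-algebra generated by a process, seen as a random element of a product space, is
generated by its coordinates. -/
lemma comap_pi_eq_iSup {ι Ω β : Type*} [MeasurableSpace β] (X : ι → Ω → β) :
    MeasurableSpace.comap (fun ω i => X i ω) MeasurableSpace.pi =
      ⨆ i, MeasurableSpace.comap (X i) inferInstance := by
  simp_rw [MeasurableSpace.pi, MeasurableSpace.comap_iSup, MeasurableSpace.comap_comp]
  rfl

/-- Since `Λ` maps `[0, ∞)` onto `[0, ∞)`, independence from the time-changed process
`N₁(Λ(t))` is independence from `N₁` itself. -/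
lemma indep_initialHistory {Ω : Type*} [MeasurableSpace Ω] {P : Measure Ω}
    {lam : ℝ → ℝ} (hlam : IsRate lam) {N₁ : ℝ≥0 → Ω → ℕ} {Y : ℝ≥0 → Ω → ℝ≥0}
    (hindep : IndepFun (fun ω t => Y t ω) (fun ω t => nonhomPoisson N₁ lam t ω) P) :
    Indep (initialHistory Y) (⨆ t, MeasurableSpace.comap (N₁ t) inferInstance) P := by
  rw [IndepFun_iff_Indep, comap_pi_eq_iSup, comap_pi_eq_iSup] at hindep
  refine indep_of_indep_of_le_right hindep (iSup_le fun s => ?_)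
  obtain ⟨t, rfl⟩ := hlam.exists_cumRate_eq s
  exact le_iSup (fun t => MeasurableSpace.comap (nonhomPoisson N₁ lam t) inferInstance) t

/-! ### Central limit theorem for the Poisson law -/

/-- The characteristic function at `x` of `(n - m) / √m`, where `n` has the Poisson law of
parameter `m`, is `exp (m (exp (i s) - 1 - i s))` with `s = x / √m`. It tends to `exp (-x² / 2)`
by the second-order expansion of the exponential. -/
lemma tendsto_poisson_charFun (x : ℝ) :
    Tendsto (fun m : ℝ≥0 => Complex.exp ((m : ℝ) *
      (Complex.exp ((x / √(m : ℝ) : ℝ) * Complex.I) - 1 - (x / √(m : ℝ) : ℝ) * Complex.I)))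
      atTop (𝓝 (Complex.exp (-(x : ℂ) ^ 2 / 2))) := by
  refine (Complex.continuous_exp.tendsto _).comp ?_
  have hw : Tendsto (fun m : ℝ≥0 => ((x / √(m : ℝ) : ℝ) : ℂ) * Complex.I) atTop (𝓝 0) := by
    have h1 : Tendsto (fun m : ℝ≥0 => x / √(m : ℝ)) atTop (𝓝 0) :=
      tendsto_const_nhds.div_atTop (Real.tendsto_sqrt_atTop.comp
        (NNReal.tendsto_coe_atTop.2 tendsto_id))
    have h2 := (Complex.continuous_ofReal.tendsto 0).comp h1
    simpa using h2.mul_const Complex.I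
  have ho := ((Complex.exp_sub_sum_range_succ_isLittleO_pow 2).tendsto_div_nhds_zero).comp hw
  have hlim := (ho.const_mul (-(x : ℂ) ^ 2)).add_const (-(x : ℂ) ^ 2 / 2)
  rw [mul_zero, zero_add] at hlim
  refine hlim.congr' ?_
  filter_upwards [eventually_gt_atTop 0] with m hm
  have hm' : (0 : ℝ) < √(m : ℝ) := Real.sqrt_pos.2 hm
  have hs : ((m : ℝ) : ℂ) = (√(m : ℝ) : ℂ) ^ 2 := by
    rw [← Complex.ofReal_pow, Real.sq_sqrt m.coe_nonneg]
  have hm0 : (√(m : ℝ) : ℂ) ≠ 0 := by exact_mod_cast hm'.ne'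
  rcases eq_or_ne x 0 with rfl | hx
  · simp
  have hx' : (x : ℂ) ≠ 0 := by exact_mod_cast hx
  simp only [Function.comp_apply, Finset.sum_range_succ, Finset.sum_range_zero, hs,
    Complex.ofReal_div]
  field_simp
  simp [Nat.factorial]
  ring

/-- The standardisation map of the Poisson law of parameter `m`; it is constantly `0` for `m = 0`. -/
noncomputable def standardize (m : ℝ≥0) (n : ℕ) : ℝ := ((n : ℝ) - m) / √(m : ℝ)

lemma charFun_map_standardize {m : ℝ≥0} (hm : 0 < m) (x : ℝ) :
    charFun ((poissonMeasure m).map (standardize m)) x = Complex.exp ((m : ℝ) *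
      (Complex.exp ((x / √(m : ℝ) : ℝ) * Complex.I) - 1 - (x / √(m : ℝ) : ℝ) * Complex.I)) := by
  have hm' : (0 : ℝ) < √(m : ℝ) := Real.sqrt_pos.2 hm
  have hs : ((m : ℝ) : ℂ) = (√(m : ℝ) : ℂ) ^ 2 := by
    rw [← Complex.ofReal_pow, Real.sq_sqrt m.coe_nonneg]
  have hm0 : (√(m : ℝ) : ℂ) ≠ 0 := by exact_mod_cast hm'.ne'
  have hmap : (poissonMeasure m).map (standardize m) =
      (((poissonMeasure m).map (Nat.cast : ℕ → ℝ)).map (· + -(m : ℝ))).map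
        ((√(m : ℝ))⁻¹ * ·) := by
    rw [Measure.map_map (by fun_prop) (by fun_prop), Measure.map_map (by fun_prop) (by fun_prop)]
    congr 1
    ext n
    simp [standardize, div_eq_inv_mul, sub_eq_add_neg]
  rw [hmap, charFun_map_mul, charFun_map_add_const, charFun_map_cast_poissonMeasure,
    ← Complex.exp_add]
  congr 1
  have h1 : (√(m : ℝ))⁻¹ * x = x / √(m : ℝ) := inv_mul_eq_div _ _
  simp only [h1, Real.inner_apply]
  push_cast
  ring

/-- Central limit theorem for the Poisson law as its parameter tends to infinity through the reals,
tested on a continuity set of the Gaussian law. -/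
lemma tendsto_poissonMeasure_standardize {A : Set ℝ} (hA : MeasurableSet A)
    (hA' : gaussianReal 0 1 (frontier A) = 0) :
    Tendsto (fun m : ℝ≥0 => poissonMeasure m (standardize m ⁻¹' A)) atTop
      (𝓝 (gaussianReal 0 1 A)) := by
  have hprob : ∀ m, IsProbabilityMeasure ((poissonMeasure m).map (standardize m)) := fun m =>
    Measure.isProbabilityMeasure_map Measurable.of_discrete.aemeasurable
  refine tendsto_of_seq_tendsto fun u hu => ?_
  let μ : ℕ → ProbabilityMeasure ℝ := fun n => ⟨_, hprob (u n)⟩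
  let γ : ProbabilityMeasure ℝ := ⟨gaussianReal 0 1, inferInstance⟩
  have hμ : Tendsto μ atTop (𝓝 γ) := by
    refine ProbabilityMeasure.tendsto_of_tendsto_charFun fun x => ?_
    have h : charFun (γ : Measure ℝ) x = Complex.exp (-(x : ℂ) ^ 2 / 2) := by
      simp [γ, charFun_gaussianReal, neg_div]
    rw [h]
    refine ((tendsto_poisson_charFun x).comp hu).congr' ?_
    filter_upwards [hu.eventually_gt_atTop 0] with n hn
    exact (charFun_map_standardize hn x).symm
  have := ProbabilityMeasure.tendsto_measure_of_null_frontier_of_tendsto' hμ (E := A) hA'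
  refine this.congr fun n => ?_
  exact Measure.map_apply .of_discrete hA

/-! ### A Gaussian variable carried by a Poisson process -/

/-- The first jump time `inf {t : N(t) > 0}`, which is `0` on paths without a jump: the passage time
of `N` above the level `0`. -/
noncomputable def firstJump {Ω : Type*} (N : ℝ≥0 → Ω → ℕ) : Ω → ℝ≥0 :=
  inverseSubordinator (fun t ω => (N t ω : ℝ)) 0

/-- `exp (-T)`, with `T` the first jump time, as a point of `[0, 1]`. -/
noncomputable def expFirstJump {Ω : Type*} (N : ℝ≥0 → Ω → ℕ) (ω : Ω) : unitInterval :=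
  ⟨Real.exp (-firstJump N ω), (Real.exp_pos _).le, Real.exp_le_one_iff.2 (by simp)⟩

lemma measurable_expFirstJump {Ω : Type*} [MeasurableSpace Ω] {N : ℝ≥0 → Ω → ℕ} (hN : ∀ t, Measurable (N t))
    (hr : ∀ ω t, ContinuousWithinAt (fun s => (N s ω : ℝ)) (Set.Ici t) t) :
    Measurable (expFirstJump N) := by
  have h := measurable_inverseSubordinator (L := fun t ω => (N t ω : ℝ))
    (fun t => Measurable.of_discrete.comp (hN t)) hr 0
  exact (Real.measurable_exp.comp h.coe_nnreal_real.neg).subtype_mk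

section Poisson

variable {Ω : Type*} [MeasurableSpace Ω] {P : Measure Ω} {N : ℝ≥0 → Ω → ℕ}

lemma IsStandardPoisson.hasLaw (hN : IsStandardPoisson N P) (t : ℝ≥0) :
    HasLaw (N t) (poissonMeasure t) P := by
  have h := hN.law 0 t (zero_le)
  rw [tsub_zero] at h
  refine h.congr ?_
  filter_upwards [hN.zero] with ω hω
  simp [hω]

lemma IsStandardPoisson.measure_eq_zero (hN : IsStandardPoisson N P) (t : ℝ≥0) :
    P {ω | N t ω = 0} = ENNReal.ofReal (Real.exp (-t)) := by
  have h := (hN.hasLaw t).map_eq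
  have h1 : P (N t ⁻¹' {0}) = poissonMeasure t {0} := by
    rw [← h, Measure.map_apply (hN.measurable t) (measurableSet_singleton 0)]
  rw [poissonMeasure_singleton] at h1
  simpa [Set.preimage] using h1

lemma IsStandardPoisson.ae_exists_pos [IsProbabilityMeasure P] (hN : IsStandardPoisson N P) :
    ∀ᵐ ω ∂P, ∃ t, 0 < N t ω := by
  have hbound : ∀ n : ℕ, P {ω | ¬ ∃ t, 0 < N t ω} ≤ ENNReal.ofReal (Real.exp (-n)) := fun n => by
    rw [← NNReal.coe_natCast, ← hN.measure_eq_zero n]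
    refine measure_mono fun ω hω => ?_
    simp only [not_exists, not_lt, Set.mem_ofPred_eq, nonpos_iff_eq_zero] at hω
    exact hω n
  have h0 : Tendsto (fun n : ℕ => ENNReal.ofReal (Real.exp (-(n : ℝ)))) atTop (𝓝 0) := by
    have := ENNReal.tendsto_ofReal (Real.tendsto_exp_atBot.comp
      (tendsto_neg_atTop_atBot.comp (tendsto_natCast_atTop_atTop (R := ℝ))))
    simpa using this
  exact le_antisymm (ge_of_tendsto' h0 hbound) zero_le

lemma IsStandardPoisson.rightCont_cast (hN : IsStandardPoisson N P) (ω : Ω) (t : ℝ≥0) :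
    ContinuousWithinAt (fun s => (N s ω : ℝ)) (Set.Ici t) t :=
  continuous_of_discreteTopology.continuousAt.comp_continuousWithinAt (hN.rightCont ω t)

lemma IsStandardPoisson.firstJump_le_iff (hN : IsStandardPoisson N P) {ω : Ω}
    (hω : ∃ t, 0 < N t ω) (t : ℝ≥0) : firstJump N ω ≤ t ↔ 0 < N t ω := by
  have hset : {u : ℝ≥0 | ((0 : ℝ≥0) : ℝ) < (N u ω : ℝ)} = {u | 0 < N u ω} := by simp
  rw [firstJump, inverseSubordinator, hset]
  refine ⟨fun h => ?_, fun h => csInf_le' h⟩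
  by_contra h0
  -- If `N(t) = 0` then, by right-continuity, `N` still vanishes shortly after `t`.
  have h1 : ∀ᶠ s in 𝓝[≥] t, N s ω = 0 :=
    (hN.rightCont ω t).tendsto.eventually (IsOpen.mem_nhds (isOpen_discrete {k | k = 0})
      (by simpa using h0))
  obtain ⟨u, hu, hu'⟩ := (mem_nhdsGE_iff_exists_Ico_subset' (lt_add_one t)).1 h1
  refine (lt_of_lt_of_le (Set.mem_Ioi.1 hu) (le_csInf hω fun v hv => ?_)).not_ge h
  by_contra! hvu
  rcases le_total v t with hvt | htv
  · exact h0 (lt_of_lt_of_le hv (hN.mono ω hvt))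
  · exact (show 0 < N v ω from hv).ne' (hu' ⟨htv, hvu⟩)

/-- The first jump time `T` is exponentially distributed, so `exp (-T)` is uniform on `[0, 1]`. -/
lemma IsStandardPoisson.map_expFirstJump [IsProbabilityMeasure P] (hN : IsStandardPoisson N P) :
    P.map (expFirstJump N) = volume := by
  have hm := measurable_expFirstJump hN.measurable hN.rightCont_cast
  have := Measure.isProbabilityMeasure_map (μ := P) hm.aemeasurable
  refine Measure.ext_of_Ici _ _ fun x => ?_
  rw [Measure.map_apply hm measurableSet_Ici, unitInterval.volume_Ici]
  rcases eq_or_ne x 0 with rfl | hx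
  · simp
  have hx0 : (0 : ℝ) < x := lt_of_le_of_ne x.2.1 fun h => hx (Subtype.ext h.symm)
  have hlog : 0 ≤ -Real.log x := by simpa using Real.log_nonpos x.2.1 x.2.2
  let t : ℝ≥0 := ⟨-Real.log x, hlog⟩
  have hae : expFirstJump N ⁻¹' Set.Ici x =ᵐ[P] ({ω | N t ω = 0}ᶜ : Set Ω) := by
    filter_upwards [hN.ae_exists_pos] with ω hω
    refine propext ?_
    change (x : ℝ) ≤ Real.exp (-firstJump N ω) ↔ ¬ N t ω = 0
    rw [← Real.log_le_iff_le_exp hx0, le_neg, ← ne_eq, ← Nat.pos_iff_ne_zero, ← hN.firstJump_le_iff hω]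
    exact Iff.rfl
  have hms : MeasurableSet {ω | N t ω = 0} := hN.measurable t (measurableSet_singleton 0)
  rw [measure_congr hae, prob_compl_eq_one_sub hms,
    hN.measure_eq_zero, ENNReal.ofReal_sub _ x.2.1, ENNReal.ofReal_one]
  rw [show (t : ℝ) = -Real.log x from rfl, neg_neg, Real.exp_log hx0]

/-- A Poisson process carries a standard Gaussian variable. -/
lemma IsStandardPoisson.exists_gaussian [IsProbabilityMeasure P] (hN : IsStandardPoisson N P) :
    ∃ W : Ω → ℝ, HasLaw W (gaussianReal 0 1) P ∧
      Measurable[⨆ t, MeasurableSpace.comap (N t) inferInstance] W := by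
  obtain ⟨f, hf, hmap⟩ := (gaussianReal 0 1).exists_measurable_map_eq
  have hm := measurable_expFirstJump hN.measurable hN.rightCont_cast
  refine ⟨f ∘ expFirstJump N, ⟨(hf.comp hm).aemeasurable, ?_⟩, ?_⟩
  · rw [← Measure.map_map hf hm, hN.map_expFirstJump, hmap]
  · refine hf.comp (@measurable_expFirstJump Ω
      (⨆ t, MeasurableSpace.comap (N t) inferInstance) N (fun t => ?_) hN.rightCont_cast)
    exact (comap_measurable (N t)).mono
      (le_iSup (fun t => MeasurableSpace.comap (N t) inferInstance) t) le_rfl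

end Poisson

/-! ### Stable convergence -/

/-- If `f` and `g` are independent and `M` is a jointly measurable process driven by `g`, then
evaluating `M` at a random time that depends on `f` alone amounts to freezing that time and
integrating out `g`. -/
lemma measure_eval_inter_eq_lintegral {Ω Ω₁ Ω₂ β : Type*} [MeasurableSpace Ω] [MeasurableSpace Ω₁]
    [MeasurableSpace Ω₂] [MeasurableSpace β] {P : Measure Ω} [IsProbabilityMeasure P]
    {f : Ω → Ω₁} {g : Ω → Ω₂} (hf : Measurable f) (hg : Measurable g) (hfg : IndepFun f g P)
    {Z : Ω₁ → ℝ≥0} (hZ : Measurable Z) {M : ℝ≥0 → Ω₂ → β}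
    (hM : Measurable fun p : ℝ≥0 × Ω₂ => M p.1 p.2) {C : Set (ℝ≥0 × β)} (hC : MeasurableSet C)
    {B : Set Ω₁} (hB : MeasurableSet B) :
    P ({ω | (Z (f ω), M (Z (f ω)) (g ω)) ∈ C} ∩ f ⁻¹' B) =
      ∫⁻ ω in f ⁻¹' B, P {ω' | (Z (f ω), M (Z (f ω)) (g ω')) ∈ C} ∂P := by
  let D : Set (Ω₁ × Ω₂) := {p | (Z p.1, M (Z p.1) p.2) ∈ C}
  have hD : MeasurableSet D := by
    have : Measurable fun p : Ω₁ × Ω₂ => (Z p.1, M (Z p.1) p.2) :=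
      (hZ.comp measurable_fst).prodMk
        (hM.comp ((hZ.comp measurable_fst).prodMk measurable_snd))
    exact this hC
  have hD' : MeasurableSet (D ∩ Prod.fst ⁻¹' B) := hD.inter (measurable_fst hB)
  have h := (indepFun_iff_map_prod_eq_prod_map_map hf.aemeasurable hg.aemeasurable).1 hfg
  have h1 : P ({ω | (Z (f ω), M (Z (f ω)) (g ω)) ∈ C} ∩ f ⁻¹' B) =
      ((P.map f).prod (P.map g)) (D ∩ Prod.fst ⁻¹' B) := by
    rw [← h, Measure.map_apply (hf.prodMk hg) hD']
    rfl
  have := Measure.isProbabilityMeasure_map (μ := P) hg.aemeasurable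
  rw [h1, Measure.prod_apply hD', lintegral_map (measurable_measure_prodMk_left hD') hf,
    ← lintegral_indicator (hf hB)]
  refine lintegral_congr fun ω => ?_
  by_cases hω : f ω ∈ B
  · rw [Set.indicator_of_mem (by exact hω), Measure.map_apply hg (measurable_prodMk_left hD')]
    congr 1
    ext ω'
    simp [D, hω]
  · rw [Set.indicator_of_notMem (by exact hω)]
    have : Prod.mk (f ω) ⁻¹' (D ∩ Prod.fst ⁻¹' B) = ∅ := by ext; simp [hω]
    simp [this]

lemma measurable_standardize : Measurable fun p : ℝ≥0 × ℕ => standardize p.1 p.2 := by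
  unfold standardize
  fun_prop

/-- Randomised central limit theorem: a process with Poisson one-dimensional laws, driven by `g` and
observed at random times that depend on an independent `f` and diverge almost surely, is
asymptotically Gaussian after standardisation, jointly with every event that depends on `f`. -/
lemma tendsto_measure_standardize_inter {Ω Ω₁ Ω₂ : Type*} [MeasurableSpace Ω] [MeasurableSpace Ω₁]
    [MeasurableSpace Ω₂] {P : Measure Ω} [IsProbabilityMeasure P]
    {f : Ω → Ω₁} {g : Ω → Ω₂} (hf : Measurable f) (hg : Measurable g) (hfg : IndepFun f g P)
    {M : ℝ≥0 → Ω₂ → ℕ} (hM : Measurable fun p : ℝ≥0 × Ω₂ => M p.1 p.2)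
    (hlaw : ∀ m, HasLaw (fun ω => M m (g ω)) (poissonMeasure m) P)
    {Z : ℝ≥0 → Ω₁ → ℝ≥0} (hZ : ∀ T, Measurable (Z T))
    (hZlim : ∀ᵐ ω ∂P, Tendsto (fun T => Z T (f ω)) atTop atTop)
    {B : Set Ω₁} (hB : MeasurableSet B) {A : Set ℝ} (hA : MeasurableSet A)
    (hA' : gaussianReal 0 1 (frontier A) = 0) :
    Tendsto (fun T => P ((fun ω => standardize (Z T (f ω)) (M (Z T (f ω)) (g ω))) ⁻¹' A ∩ f ⁻¹' B))
      atTop (𝓝 (gaussianReal 0 1 A * P (f ⁻¹' B))) := by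
  let C : Set (ℝ≥0 × ℕ) := {p | standardize p.1 p.2 ∈ A}
  have hC : MeasurableSet C := measurable_standardize hA
  let φ : ℝ≥0 → ℝ≥0∞ := fun m => poissonMeasure m (standardize m ⁻¹' A)
  have hMg : Measurable fun p : ℝ≥0 × Ω => M p.1 (g p.2) :=
    hM.comp (measurable_fst.prodMk (hg.comp measurable_snd))
  have hφ : ∀ m, P {ω | (m, M m (g ω)) ∈ C} = φ m := fun m => by
    change _ = poissonMeasure m (standardize m ⁻¹' A)
    rw [← (hlaw m).map_eq, Measure.map_apply (f := fun ω => M m (g ω))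
      (hMg.comp measurable_prodMk_left) .of_discrete]
    rfl
  have hφm : Measurable φ := by
    have hmeas : Measurable fun p : ℝ≥0 × Ω => (p.1, M p.1 (g p.2)) := measurable_fst.prodMk hMg
    rw [← funext hφ]
    exact measurable_measure_prodMk_left (ν := P) (hmeas hC)
  have hfreeze : ∀ T,
      P ((fun ω => standardize (Z T (f ω)) (M (Z T (f ω)) (g ω))) ⁻¹' A ∩ f ⁻¹' B) =
        ∫⁻ ω in f ⁻¹' B, φ (Z T (f ω)) ∂P := fun T => by
    have h := measure_eval_inter_eq_lintegral hf hg hfg (hZ T) hM hC hB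
    simp only [hφ] at h
    exact h
  simp_rw [hfreeze]
  have hlim := tendsto_lintegral_filter_of_dominated_convergence (μ := P.restrict (f ⁻¹' B))
    (l := (atTop : Filter ℝ≥0)) (F := fun T ω => φ (Z T (f ω))) (f := fun _ => gaussianReal 0 1 A)
    (fun _ => 1) (.of_forall fun T => hφm.comp ((hZ T).comp hf))
    (.of_forall fun T => .of_forall fun ω => prob_le_one) (by simp) ?_
  · simpa using hlim
  · filter_upwards [ae_restrict_of_ae hZlim] with ω hω
    exact (tendsto_poissonMeasure_standardize hA hA').comp hω

lemma measurable_fnpp {Ω : Type*} [MeasurableSpace Ω] {lam : ℝ → ℝ} (hlam : IsRate lam)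
    {N₁ : ℝ≥0 → Ω → ℕ} {L : ℝ≥0 → Ω → ℝ} (hN : Measurable fun p : ℝ≥0 × Ω => N₁ p.1 p.2) {t : ℝ≥0}
    (hY : Measurable (inverseSubordinator L t)) : Measurable (fnpp N₁ lam L t) := by
  have hΛ : Measurable fun t => (cumRate lam t).toNNReal :=
    hlam.continuous_cumRate.measurable.real_toNNReal
  have h : Measurable fun ω => ((cumRate lam (inverseSubordinator L t ω)).toNNReal, ω) :=
    (hΛ.comp hY).prodMk measurable_id
  exact hN.comp h

lemma normalized_fnpp_eq_standardize {Ω : Type*} {lam : ℝ → ℝ} (hlam : IsRate lam)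
    (N₁ : ℝ≥0 → Ω → ℕ) (L : ℝ≥0 → Ω → ℝ) (T : ℝ≥0) (ω : Ω) :
    ((fnpp N₁ lam L T ω : ℝ) - cumRate lam (inverseSubordinator L T ω)) /
      √(cumRate lam (inverseSubordinator L T ω)) =
      standardize (cumRate lam (inverseSubordinator L T ω)).toNNReal
        (N₁ (cumRate lam (inverseSubordinator L T ω)).toNNReal ω) := by
  rw [standardize, Real.coe_toNNReal _ (hlam.cumRate_nonneg _)]
  rfl

/-- The randomised central limit theorem at the times `Λ(Y(T))`, which are measurable for the initial
history and tend to infinity almost surely. -/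
lemma tendsto_measure_normalized_fnpp_inter {Ω : Type*} [mΩ : MeasurableSpace Ω] {P : Measure Ω}
    [IsProbabilityMeasure P] {α : ℝ} {lam : ℝ → ℝ} (hlam : IsRate lam)
    {N₁ : ℝ≥0 → Ω → ℕ} (hN₁ : IsStandardPoisson N₁ P)
    {L : ℝ≥0 → Ω → ℝ} (hL : IsStableSubordinator α L P)
    (hind : Indep (initialHistory (inverseSubordinator L))
      (⨆ t, MeasurableSpace.comap (N₁ t) inferInstance) P)
    {B : Set Ω} (hB : MeasurableSet[initialHistory (inverseSubordinator L)] B)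
    {A : Set ℝ} (hA : MeasurableSet A) (hA' : gaussianReal 0 1 (frontier A) = 0) :
    Tendsto (fun T => P ((fun ω =>
      ((fnpp N₁ lam L T ω : ℝ) - cumRate lam (inverseSubordinator L T ω)) /
        √(cumRate lam (inverseSubordinator L T ω))) ⁻¹' A ∩ B)) atTop
      (𝓝 (gaussianReal 0 1 A * P B)) := by
  simp_rw [normalized_fnpp_eq_standardize hlam]
  have hZlim : ∀ᵐ ω ∂P, Tendsto (fun T => (cumRate lam (inverseSubordinator L T ω)).toNNReal)
      atTop atTop := by
    filter_upwards [hL.ae_unbounded] with ω hω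
    exact tendsto_real_toNNReal_atTop.comp (hlam.tendsto.comp
      (tendsto_inverseSubordinator_atTop (hL.rightCont ω) (hL.leftLim ω) hω))
  have h𝓖 : initialHistory (inverseSubordinator L) ≤ mΩ :=
    iSup_le fun t => (measurable_inverseSubordinator hL.measurable hL.rightCont t).comap_le
  have h𝓗 : (⨆ t, MeasurableSpace.comap (N₁ t) inferInstance) ≤ mΩ :=
    iSup_le fun t => (hN₁.measurable t).comap_le
  -- The two sources of randomness are the identity maps onto `Ω` with the `σ`-algebras generated
  -- by the inverse subordinator and by the Poisson process.
  have hid : @IndepFun Ω Ω Ω mΩ (initialHistory (inverseSubordinator L))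
      (⨆ t, MeasurableSpace.comap (N₁ t) inferInstance) id id P := by
    refine (IndepFun_iff_Indep (mβ := initialHistory (inverseSubordinator L))
      (mγ := ⨆ t, MeasurableSpace.comap (N₁ t) inferInstance) id id P).2 ?_
    simpa only [MeasurableSpace.comap_id] using hind
  have hN := @measurable_uncurry_of_rightCont Ω ℕ
    (⨆ t, MeasurableSpace.comap (N₁ t) inferInstance) _ _ _ _ N₁
    (fun t => (comap_measurable (N₁ t)).mono
      (le_iSup (fun t => MeasurableSpace.comap (N₁ t) inferInstance) t) le_rfl) hN₁.rightCont
  have hZ : ∀ T, Measurable[initialHistory (inverseSubordinator L)]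
      fun ω => (cumRate lam (inverseSubordinator L T ω)).toNNReal := fun T =>
    hlam.continuous_cumRate.measurable.real_toNNReal.comp
      ((comap_measurable (inverseSubordinator L T)).mono
        (le_iSup (fun t => MeasurableSpace.comap (inverseSubordinator L t) inferInstance) T) le_rfl)
  exact @tendsto_measure_standardize_inter Ω Ω Ω mΩ (initialHistory (inverseSubordinator L))
    (⨆ t, MeasurableSpace.comap (N₁ t) inferInstance) P _ id id (measurable_id'' h𝓖)
    (measurable_id'' h𝓗) hid N₁ hN hN₁.hasLaw
    (fun T ω => (cumRate lam (inverseSubordinator L T ω)).toNNReal) hZ hZlim B hB A hA hA'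

end FractionalPoisson

open FractionalPoisson

theorem mainTheorem4 {Ω : Type*} [mΩ : MeasurableSpace Ω] (P : Measure Ω) [IsProbabilityMeasure P]
    (α : ℝ) (hα : α ∈ Set.Ioo (0 : ℝ) 1)
    (lam : ℝ → ℝ) (hlam : FractionalPoisson.IsRate lam)
    (N₁ : ℝ≥0 → Ω → ℕ) (hN₁ : FractionalPoisson.IsStandardPoisson N₁ P)
    (L : ℝ≥0 → Ω → ℝ) (hL : FractionalPoisson.IsStableSubordinator α L P)
    (hindep : IndepFun (fun ω t => FractionalPoisson.inverseSubordinator L t ω)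
      (fun ω t => FractionalPoisson.nonhomPoisson N₁ lam t ω) P) :
    ∃ 𝓕 : Filtration ℝ≥0 mΩ,
      (∀ t, 𝓕 t = FractionalPoisson.initialHistory (FractionalPoisson.inverseSubordinator L) ⊔
        FractionalPoisson.naturalHistory (FractionalPoisson.fnpp N₁ lam L) t) ∧
      Adapted 𝓕 (FractionalPoisson.fnpp N₁ lam L) ∧
      ∃ W : Ω → ℝ, HasLaw W (gaussianReal 0 1) P ∧
        Indep (MeasurableSpace.comap W inferInstance)
          (FractionalPoisson.initialHistory (FractionalPoisson.inverseSubordinator L)) P ∧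
        FractionalPoisson.TendstoStably
          (FractionalPoisson.initialHistory (FractionalPoisson.inverseSubordinator L))
          (fun (T : ℝ≥0) ω =>
            ((FractionalPoisson.fnpp N₁ lam L T ω : ℝ) -
                FractionalPoisson.cumRate lam (FractionalPoisson.inverseSubordinator L T ω)) /
              √(FractionalPoisson.cumRate lam (FractionalPoisson.inverseSubordinator L T ω)))
          atTop W P := by
  have hY : ∀ t, Measurable (inverseSubordinator L t) :=
    measurable_inverseSubordinator hL.measurable hL.rightCont
  have hX : ∀ t, Measurable (fnpp N₁ lam L t) := fun t =>
    measurable_fnpp hlam (measurable_uncurry_of_rightCont hN₁.measurable hN₁.rightCont) (hY t)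
  have h𝓖 : initialHistory (inverseSubordinator L) ≤ mΩ := iSup_le fun t => (hY t).comap_le
  have hind := indep_initialHistory hlam hindep
  have hmono : Monotone fun t =>
      initialHistory (inverseSubordinator L) ⊔ naturalHistory (fnpp N₁ lam L) t := fun s t hst =>
    sup_le_sup_left (biSup_mono fun r hr => hr.trans hst) _
  refine ⟨⟨_, hmono, fun t => sup_le h𝓖 (iSup_le fun s => iSup_le fun _ => (hX s).comap_le)⟩,
    fun t => rfl, fun t => ?_, ?_⟩
  · exact measurable_iff_comap_le.2 (le_sup_of_le_right
      (le_iSup₂_of_le (f := fun s (_ : s ≤ t) =>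
        MeasurableSpace.comap (fnpp N₁ lam L s) inferInstance) t le_rfl le_rfl))
  obtain ⟨W, hW, hWm⟩ := hN₁.exists_gaussian
  have hWind : Indep (MeasurableSpace.comap W inferInstance)
      (initialHistory (inverseSubordinator L)) P :=
    (indep_of_indep_of_le_right hind hWm.comap_le).symm
  have hWm' : Measurable W := hWm.mono (iSup_le fun t => (hN₁.measurable t).comap_le) le_rfl
  refine ⟨W, hW, hWind, h𝓖, fun T => ?_, hWm', fun B hB A hA hA' => ?_⟩
  · have hc : Measurable fun ω => cumRate lam (inverseSubordinator L T ω) :=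
      hlam.continuous_cumRate.measurable.comp (hY T)
    have hX' : Measurable fun ω => (fnpp N₁ lam L T ω : ℝ) := Measurable.of_discrete.comp (hX T)
    exact (hX'.sub hc).div hc.sqrt
  · have hγ : ∀ S, MeasurableSet S → P (W ⁻¹' S) = gaussianReal 0 1 S := fun S hS => by
      rw [← hW.map_eq, Measure.map_apply hWm' hS]
    rw [hγ _ isClosed_frontier.measurableSet] at hA'
    rw [(Indep_iff _ _ P).1 hWind _ B ⟨A, hA, rfl⟩ hB, hγ A hA]
    exact tendsto_measure_normalized_fnpp_inter hlam hN₁ hL hind hB hA hA'
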